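/- Consider the scheduling problem $P||\sum w_jC_j$ on $m\ge 1$ identical parallel machines: there are finitely many jobs, job $j$ having a processing time $p_j>0$ and a weight $w_j>0$; each job has to be processed for $p_j$ time units without interruption on one of the machines, every machine processes at most one job at a time, and no job starts before time $0$. If $C_j^S$ denotes the completion time of job $j$ in the schedule $S$, the cost of $S$ is $\sum_j w_jC_j^S$; let $\mathrm{OPT}_m(I)$ be the minimum cost of a feasible schedule for the instance $I$ on $m$ machines. The WSPT rule lists the jobs in an order of non-increasing ratios $w_j/p_j$ (ties broken arbitrarily) and schedules them in this order, assigning each job to a currently least loaded machine, where it starts as soon as the jobs previously assigned to that machine are finished. Let $k_m$ be the nearest integer to $\bigl(1-\frac{\sqrt2}{2}\bigr)m$ and \[\rho_m = 1+\frac12\cdot\frac{\sqrt{(2m-k_m)k_m}-k_m}{m}.\] Then for every fixed $m\ge 1$: (a) for every instance $I$, every schedule produced by the WSPT rule on $m$ machines has cost at most $\rho_m\cdot\mathrm{OPT}_m(I)$; (b) this bound is tight: for every $\varepsilon>0$ there are a nonempty instance $I$ and a WSPT schedule for $I$ on $m$ machines whose cost is at least $(\rho_m-\varepsilon)\,\mathrm{OPT}_m(I)$.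 Moreover, $\rho_m=\frac12(1+\sqrt2)-O(1/m^2)$; precisely, there is a constant $C$ such that $0\le\frac12(1+\sqrt2)-\rho_m\le C/m^2$ for all $m\ge1$. -/

import Mathlib

namespace ParallelScheduling

/-- An instance with `n` jobs: job `j` has processing time `p j > 0` and weight `w j > 0`. -/
structure JobSet (n : ℕ) where
  p : Fin n → ℝ
  w : Fin n → ℝ
  p_pos : ∀ j, 0 < p j
  w_pos : ∀ j, 0 < w j

/-- A feasible non-preemptive schedule of the jobs on `m` identical parallel machines: job `j`
occupies machine `machine j` during the time interval from `start j` to `start j + p j`, and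
every machine processes at most one job at a time. -/
structure Schedule {n : ℕ} (I : JobSet n) (m : ℕ) where
  machine : Fin n → Fin m
  start : Fin n → ℝ
  start_nonneg : ∀ j, 0 ≤ start j
  no_overlap : ∀ j j', j ≠ j' → machine j = machine j' →
    start j + I.p j ≤ start j' ∨ start j' + I.p j' ≤ start j

namespace Schedule

variable {n m : ℕ} {I : JobSet n}

/-- The completion time of job `j`. -/
def completion (S : Schedule I m) (j : Fin n) : ℝ := S.start j + I.p j

/-- The total weighted completion time. -/
def cost (S : Schedule I m) : ℝ := ∑ j, I.w j * S.completion j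

/-- The load of machine `i` caused by the jobs at the positions before `k` of the list
`π 0, π 1, …, π (n - 1)`. -/
def loadBefore (S : Schedule I m) (π : Equiv.Perm (Fin n)) (k : Fin n) (i : Fin m) : ℝ :=
  ∑ l with l < k ∧ S.machine (π l) = i, I.p (π l)

/-- `S` arises by list scheduling in the order `π 0, π 1, …, π (n - 1)`: each job in turn is put
on a machine with the currently least load (any such machine) and starts there as soon as the
jobs assigned before to this machine are finished. -/
def IsListSchedule (S : Schedule I m) (π : Equiv.Perm (Fin n)) : Prop :=
  ∀ k : Fin n,
    (∀ i : Fin m, S.loadBefore π k (S.machine (π k)) ≤ S.loadBefore π k i) ∧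
    S.start (π k) = S.loadBefore π k (S.machine (π k))

/-- `S` arises by the WSPT rule, that is, by list scheduling in some order of non-increasing
Smith ratios `w j / p j` (jobs with equal ratios may come in any order). -/
def IsWSPT (S : Schedule I m) : Prop :=
  ∃ π : Equiv.Perm (Fin n),
    (∀ k l : Fin n, k ≤ l → I.w (π l) / I.p (π l) ≤ I.w (π k) / I.p (π k)) ∧
    S.IsListSchedule π

end Schedule

/-- The optimal total weighted completion time of the instance `I` on `m` machines. The infimum
is over a set of non-negative reals which is nonempty for `m ≥ 1`. -/
noncomputable def optCost {n : ℕ} (I : JobSet n) (m : ℕ) : ℝ :=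
  ⨅ S : Schedule I m, S.cost

/-- The nearest integer to `(1 - √2 / 2) m` (there is no tie if `m ≥ 1`). -/
noncomputable def nearestK (m : ℕ) : ℤ := round ((1 - √2 / 2) * (m : ℝ))

/-- The number `1 + (1 / 2) (√((2 m - k) k) - k) / m` with `k` the nearest integer to
`(1 - √2 / 2) m`. -/
noncomputable def wsptRatio (m : ℕ) : ℝ :=
  1 + 1 / 2 * ((√((2 * (m : ℝ) - (nearestK m : ℝ)) * (nearestK m : ℝ)) - (nearestK m : ℝ)) / (m : ℝ))

end ParallelScheduling

namespace ParallelScheduling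

open Finset

/-! ### Sums over initial segments of `Fin n` -/

/-! Upper bound. Smith ratios are non-increasing along the list, so Abel summation reduces the claim
to prefixes of the list with every weight replaced by the processing time
(`Schedule.IsWSPT.cost_le`). With unit ratios, twice the cost of a schedule without idle time is the
sum of squared machine loads plus the sum of squared job lengths, and for any feasible schedule this
is a lower bound. Let `L` be the least WSPT load and `x i` the excess over it. Each positive excess
is at most the length of some job on that machine, so the competing schedule, which must place these
jobs and the same total work, has sum of squared loads at least that obtained by pouring volume `m *
L` over the heights `x i` up to a level `y`. What remains is an inequality in `x` and `y`
(`water_filling_bound`). It is convex in each `x i` below `y`, so such values may be taken to be `0`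
or `y`; with `k` entries at least `y`, a completed square reduces it to one condition on `k`. This
condition says that `1 + lam` is at least the value of the formula for `ρ_m` at `k`, and the nearest
integer in the definition maximizes that formula over all `k ≤ m`. Tightness. Many unit jobs, spread
evenly, are followed by `k` equally long jobs; the competitor gives each long job its own machine.
-/

theorem sum_val_lt_zero {n : ℕ} (g : Fin n → ℝ) : ∑ l : Fin n with l.val < 0, g l = 0 := by
  simp

theorem sum_val_lt_succ {n : ℕ} (g : Fin n → ℝ) {K : ℕ} (h : K < n) :
    ∑ l : Fin n with l.val < K + 1, g l = ∑ l : Fin n with l.val < K, g l + g ⟨K, h⟩ := by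
  have : (univ.filter fun l : Fin n => l.val < K + 1)
      = insert ⟨K, h⟩ (univ.filter fun l : Fin n => l.val < K) := by
    ext l
    simp only [mem_filter, mem_univ, true_and, mem_insert, Fin.ext_iff]
    omega
  rw [this, sum_insert (by simp), add_comm]

theorem sum_val_lt_self {n : ℕ} (g : Fin n → ℝ) :
    ∑ l : Fin n with l.val < n, g l = ∑ l, g l := by
  rw [filter_true_of_mem fun l _ => l.isLt]

/-- Abel summation: a weighted sum with antitone nonnegative weights is nonnegative if all
partial sums are. -/
theorem sum_mul_nonneg_of_antitone {n : ℕ} (r d : Fin n → ℝ) (hr : ∀ k l, k ≤ l → r l ≤ r k)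
    (hr0 : ∀ k, 0 ≤ r k) (hd : ∀ K ≤ n, 0 ≤ ∑ l : Fin n with l.val < K, d l) :
    0 ≤ ∑ l, r l * d l := by
  -- Factoring out the last weight makes the induction work: passing to the next, smaller weight
  -- lowers the left side because the partial sum is nonnegative.
  have key : ∀ K (h : K < n), r ⟨K, h⟩ * ∑ l : Fin n with l.val < K + 1, d l
      ≤ ∑ l : Fin n with l.val < K + 1, r l * d l := by
    intro K
    induction K with
    | zero =>
      intro h
      rw [sum_val_lt_succ _ h, sum_val_lt_succ _ h, sum_val_lt_zero, sum_val_lt_zero]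
      simp
    | succ K ih =>
      intro h
      have h1 := ih (by omega)
      have h2 := mul_le_mul_of_nonneg_right
        (hr ⟨K, by omega⟩ ⟨K + 1, h⟩ (by simp)) (hd (K + 1) h.le)
      rw [sum_val_lt_succ _ h, sum_val_lt_succ (fun l => r l * d l) h]
      linarith
  rcases Nat.eq_zero_or_pos n with rfl | hn
  · simp
  · obtain ⟨K, rfl⟩ : ∃ K, n = K + 1 := ⟨n - 1, by omega⟩
    have h1 := key K (by omega)
    rw [sum_val_lt_self] at h1
    rw [sum_val_lt_self] at h1
    have h2 := hd (K + 1) le_rfl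
    rw [sum_val_lt_self] at h2
    exact (mul_nonneg (hr0 _) h2).trans h1

/-! ### Loads of the machines -/

/-- The load of machine `i` due to the first `K` jobs, where job `l` of length `q l` is put on
machine `f l`. -/
def load {n m : ℕ} (q : Fin n → ℝ) (f : Fin n → Fin m) (K : ℕ) (i : Fin m) : ℝ :=
  ∑ l : Fin n with l.val < K, if f l = i then q l else 0

section load

variable {n m : ℕ} (q : Fin n → ℝ) (f : Fin n → Fin m)

theorem load_zero (i : Fin m) : load q f 0 i = 0 := sum_val_lt_zero _

theorem load_succ {K : ℕ} (h : K < n) (i : Fin m) :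
    load q f (K + 1) i = load q f K i + if f ⟨K, h⟩ = i then q ⟨K, h⟩ else 0 :=
  sum_val_lt_succ _ h

theorem load_mono (hq : ∀ l, 0 ≤ q l) {K K' : ℕ} (h : K ≤ K') (i : Fin m) :
    load q f K i ≤ load q f K' i := by
  refine sum_le_sum_of_subset_of_nonneg ?_ ?_
  · intro l
    simp only [mem_filter, mem_univ, true_and]
    omega
  · intro l _ _
    split_ifs <;> simp [hq]

theorem load_nonneg (hq : ∀ l, 0 ≤ q l) (K : ℕ) (i : Fin m) : 0 ≤ load q f K i := by
  simpa [load_zero] using load_mono q f hq (Nat.zero_le K) i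

theorem load_eq_sum (K : ℕ) (i : Fin m) :
    load q f K i = ∑ l : Fin n with l.val < K ∧ f l = i, q l := by
  rw [load, ← filter_filter, sum_filter (s := filter _ _)]

theorem sum_load (K : ℕ) : ∑ i, load q f K i = ∑ l : Fin n with l.val < K, q l := by
  simp only [load]
  rw [sum_comm]
  simp

/-- The total cost with unit ratios when all machines run without idle time. -/
theorem two_mul_sum_mul_completion (C : Fin n → ℝ)
    (hC : ∀ l, C l = load q f l.val (f l) + q l) {K : ℕ} (hK : K ≤ n) :
    2 * ∑ l : Fin n with l.val < K, q l * C l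
      = ∑ i, load q f K i ^ 2 + ∑ l : Fin n with l.val < K, q l ^ 2 := by
  induction K with
  | zero => simp [load_zero]
  | succ K ih =>
    have h := ih (by omega)
    have hs : ∑ i, load q f (K + 1) i ^ 2
        = ∑ i, load q f K i ^ 2 + 2 * load q f K (f ⟨K, hK⟩) * q ⟨K, hK⟩ + q ⟨K, hK⟩ ^ 2 := by
      have : ∀ i, load q f (K + 1) i ^ 2 = load q f K i ^ 2
          + if f ⟨K, hK⟩ = i then 2 * load q f K i * q ⟨K, hK⟩ + q ⟨K, hK⟩ ^ 2 else 0 := by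
        intro i
        rw [load_succ q f hK]
        split_ifs <;> ring
      rw [sum_congr rfl fun i _ => this i, sum_add_distrib, sum_ite_eq]
      simp only [mem_univ, if_true]
      ring
    rw [sum_val_lt_succ _ hK, sum_val_lt_succ (fun l => q l ^ 2) hK, hs, hC]
    linarith

/-- A machine with more than the least load received a job that accounts for the excess. -/
theorem exists_job_of_load_lt (hq : ∀ l, 0 ≤ q l)
    (hf : ∀ l i, load q f l.val (f l) ≤ load q f l.val i) {K : ℕ} (hK : K ≤ n) (i i' : Fin m)
    (hlt : load q f K i' < load q f K i) :
    ∃ l : Fin n, l.val < K ∧ f l = i ∧ load q f K i - q l ≤ load q f K i' := by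
  induction K with
  | zero => simp [load_zero] at hlt
  | succ K ih =>
    by_cases hi : f ⟨K, hK⟩ = i
    -- The last job put on machine `i` is the witness: just before it, `i` had the least load, and
    -- the load of `i'` has not decreased since.
    · refine ⟨⟨K, hK⟩, by simp, hi, ?_⟩
      rw [load_succ q f hK i, if_pos hi]
      have h1 := hf ⟨K, hK⟩ i'
      have h2 := load_mono q f hq (Nat.le_succ K) i'
      rw [hi] at h1
      simp only at h1 h2
      linarith
    · have h1 : load q f (K + 1) i = load q f K i := by
        rw [load_succ q f hK i, if_neg hi, add_zero]
      have h2 := load_mono q f hq (Nat.le_succ K) i'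
      simp only [Nat.succ_eq_add_one] at h2
      obtain ⟨l, hl, hl', hl''⟩ := ih (by omega) (by linarith)
      exact ⟨l, by omega, hl', by linarith⟩

end load

/-- The jobs of a set processed one at a time, from time `0` on. -/
theorem sq_sum_add_sum_sq_le {ι : Type*} [DecidableEq ι] (q s : ι → ℝ) (hq : ∀ j, 0 < q j)
    (hs : ∀ j, 0 ≤ s j) (A : Finset ι)
    (hA : ∀ j ∈ A, ∀ j' ∈ A, j ≠ j' → s j + q j ≤ s j' ∨ s j' + q j' ≤ s j) :
    (∑ j ∈ A, q j) ^ 2 + ∑ j ∈ A, q j ^ 2 ≤ 2 * ∑ j ∈ A, q j * (s j + q j) ∧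
      ∀ t, 0 ≤ t → (∀ j ∈ A, s j + q j ≤ t) → ∑ j ∈ A, q j ≤ t := by
  induction A using Finset.induction_on_max_value (fun j => s j + q j) with
  | empty => simp
  | insert a A ha hmax ih =>
    obtain ⟨h1, h2⟩ := ih fun j hj j' hj' => hA j (mem_insert_of_mem hj) j' (mem_insert_of_mem hj')
    -- The job `a` finishing last starts after all others, hence after their total length; this is
    -- why the makespan bound is proved along with the cost bound.
    have h3 : ∑ j ∈ A, q j ≤ s a := by
      refine h2 _ (hs a) fun j hj => ?_
      have hne : j ≠ a := fun h => ha (h ▸ hj)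
      rcases hA j (mem_insert_of_mem hj) a (mem_insert_self _ _) hne with h | h
      · exact h
      · have := hmax j hj
        have := hq j
        linarith
    rw [sum_insert ha, sum_insert ha, sum_insert ha]
    refine ⟨?_, fun t _ ht => ?_⟩
    · nlinarith [mul_le_mul_of_nonneg_left h3 (hq a).le]
    · have := ht a (mem_insert_self _ _)
      linarith

/-- The total cost with unit ratios of the first `K` jobs in any feasible schedule. -/
theorem sum_load_sq_add_le {n m : ℕ} (q s : Fin n → ℝ) (f : Fin n → Fin m) (hq : ∀ j, 0 < q j)
    (hs : ∀ j, 0 ≤ s j)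
    (hf : ∀ j j', j ≠ j' → f j = f j' → s j + q j ≤ s j' ∨ s j' + q j' ≤ s j) (K : ℕ) :
    ∑ i, load q f K i ^ 2 + ∑ l : Fin n with l.val < K, q l ^ 2
      ≤ 2 * ∑ l : Fin n with l.val < K, q l * (s l + q l) := by
  have h : ∀ i, load q f K i ^ 2 + ∑ l : Fin n with l.val < K, (if f l = i then q l ^ 2 else 0)
      ≤ 2 * ∑ l : Fin n with l.val < K, (if f l = i then q l * (s l + q l) else 0) := by
    intro i
    rw [load]
    simp only [← sum_filter (s := filter _ _)]
    refine (sq_sum_add_sum_sq_le q s hq hs _ fun j hj j' hj' hne => hf j j' hne ?_).1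
    simp only [mem_filter] at hj hj'
    rw [hj.2, hj'.2]
  have h' := sum_le_sum fun i (_ : i ∈ univ) => h i
  rw [sum_add_distrib, ← mul_sum, sum_comm, sum_comm (s := univ)] at h'
  simpa using h'

/-! ### The extremal problem for the loads -/

/-- After substituting the sums over the `k` entries at least `y`, the claim is a quadratic
inequality in those entries, and `hk` is its discriminant condition. -/
theorem water_filling_bound_extreme {m : ℕ} {lam : ℝ} (hlam : 0 ≤ lam)
    (hk : ∀ k : ℕ, k ≤ m → (k : ℝ) * (m - k) ≤ 2 * lam ^ 2 * m ^ 2 + 2 * lam * m * k)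
    {y : ℝ} (hy : 0 ≤ y) (x : Fin m → ℝ) (hx0 : ∀ i, 0 ≤ x i) (hx : ∀ i, x i = 0 ∨ y ≤ x i) :
    (∑ i, max (y - x i) 0) ^ 2 + 2 * (∑ i, max (y - x i) 0) * (∑ i, x i)
        + 2 * m * ∑ i, x i ^ 2
      ≤ (1 + lam) * m * (∑ i, max (x i) y ^ 2 + ∑ i, x i ^ 2) := by
  have hm : (0 : ℝ) ≤ m := m.cast_nonneg
  have hQ : 0 ≤ ∑ i, x i ^ 2 := sum_nonneg fun i _ => sq_nonneg _
  rcases hy.eq_or_lt with rfl | hy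
  · have h1 : ∀ i, max (0 - x i) 0 = 0 := fun i => max_eq_right (by linarith [hx0 i])
    have h2 : ∀ i, max (x i) 0 = x i := fun i => max_eq_left (hx0 i)
    simp only [h1, h2, sum_const_zero]
    nlinarith [mul_nonneg (mul_nonneg hlam hm) hQ]
  set k : ℕ := #{i | y ≤ x i} with hkdef
  have hkm : k ≤ m := (card_le_univ _).trans_eq (Fintype.card_fin m)
  have hkm' : (k : ℝ) ≤ m := by exact_mod_cast hkm
  set e : Fin m → ℝ := fun i => if y ≤ x i then 1 else 0 with he
  have hek : ∑ i, e i = k := by simp [he, hkdef]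
  have hP : ∑ i, max (y - x i) 0 = (m - k) * y := by
    have : ∀ i, max (y - x i) 0 = y - e i * y := by
      intro i
      simp only [he]
      split_ifs with h
      · rw [max_eq_right (by linarith)]; ring
      · rw [(hx i).resolve_right h, max_eq_left (by linarith)]; ring
    rw [sum_congr rfl fun i _ => this i, sum_sub_distrib, ← sum_mul, hek]
    simp
    ring
  have hR : ∑ i, max (x i) y ^ 2 = ∑ i, x i ^ 2 + (m - k) * y ^ 2 := by
    have : ∀ i, max (x i) y ^ 2 = x i ^ 2 + (y ^ 2 - e i * y ^ 2) := by
      intro i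
      simp only [he]
      split_ifs with h
      · rw [max_eq_left h]; ring
      · rw [(hx i).resolve_right h, max_eq_right hy.le]; ring
    rw [sum_congr rfl fun i _ => this i, sum_add_distrib, sum_sub_distrib, ← sum_mul, hek]
    simp
    ring
  -- The sum of `(c * x i - d) ^ 2` over the `k` entries at least `y`; the others vanish.
  have hsq : ∀ c d : ℝ, 0 ≤ c ^ 2 * ∑ i, x i ^ 2 - 2 * c * d * ∑ i, x i + d ^ 2 * k := by
    intro c d
    have : ∀ i, 0 ≤ c ^ 2 * x i ^ 2 - 2 * c * d * x i + d ^ 2 * e i := by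
      intro i
      simp only [he]
      split_ifs with h
      · nlinarith [sq_nonneg (c * x i - d)]
      · rw [(hx i).resolve_right h]; simp
    have h := sum_nonneg fun i (_ : i ∈ univ) => this i
    rwa [sum_add_distrib, sum_sub_distrib, ← mul_sum, ← mul_sum, ← mul_sum, hek] at h
  rw [hP, hR]
  set X := ∑ i, x i
  set Q := ∑ i, x i ^ 2
  have hkk := hk k hkm
  have hb : (0 : ℝ) ≤ m - k := by linarith
  suffices hE : 0 ≤ 2 * lam * m * Q - 2 * (m - k) * y * X + (m - k) * y ^ 2 * (k + lam * m) by
    nlinarith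
  -- Completing the square multiplies by `2 * lam * m`. If this is zero, `hk` forces `k = 0` or `k =
  -- m` instead.
  rcases (mul_nonneg hlam hm).eq_or_lt with h0 | h0
  · have hz : (k : ℝ) * (m - k) = 0 := by
      refine le_antisymm ?_ (mul_nonneg k.cast_nonneg hb)
      have : 2 * lam ^ 2 * m ^ 2 + 2 * lam * m * k = 2 * (lam * m) ^ 2 + 2 * (lam * m) * k := by
        ring
      rw [this, ← h0] at hkk
      linarith
    rcases mul_eq_zero.1 hz with hz | hz
    · have hX : X = 0 := by
        have hk0 : k = 0 := by exact_mod_cast hz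
        refine sum_eq_zero fun i _ => (hx i).resolve_right fun h => ?_
        have := card_eq_zero.1 hk0
        exact absurd (this ▸ mem_filter.2 ⟨mem_univ i, h⟩) (notMem_empty i)
      rw [hX, hz, mul_assoc 2, ← h0]
      simp
    · rw [hz, mul_assoc 2, ← h0]
      simp
  · have h1 := hsq (2 * (lam * m)) ((m - k) * y)
    have h2 := mul_nonneg (mul_nonneg hb (sq_nonneg y)) (sub_nonneg.2 hkk)
    refine nonneg_of_mul_nonneg_right (a := 2 * (lam * m)) ?_ (by linarith)
    nlinarith

/-- The inequality `∑ (L + xᵢ)² + ∑ xᵢ² ≤ (1 + lam) (∑ max(xᵢ, y)² + ∑ xᵢ²)`, multiplied by `m`,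
where `m L = ∑ (y - xᵢ)⁺`. -/
theorem water_filling_bound {m : ℕ} {lam : ℝ} (hlam : 0 ≤ lam) (hlam1 : lam * m + 1 ≤ m)
    (hk : ∀ k : ℕ, k ≤ m → (k : ℝ) * (m - k) ≤ 2 * lam ^ 2 * m ^ 2 + 2 * lam * m * k)
    {y : ℝ} (hy : 0 ≤ y) (x : Fin m → ℝ) (hx0 : ∀ i, 0 ≤ x i) :
    (∑ i, max (y - x i) 0) ^ 2 + 2 * (∑ i, max (y - x i) 0) * (∑ i, x i)
        + 2 * m * ∑ i, x i ^ 2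
      ≤ (1 + lam) * m * (∑ i, max (x i) y ^ 2 + ∑ i, x i ^ 2) := by
  induction hc : #{i | 0 < x i ∧ x i < y} using Nat.strong_induction_on generalizing x with
  | _ c ih =>
  by_cases hex : ∃ i, 0 < x i ∧ x i < y
  swap
  · push Not at hex
    refine water_filling_bound_extreme hlam hk hy x hx0 fun i => ?_
    rcases (hx0 i).eq_or_lt with h | h
    · exact Or.inl h.symm
    · exact Or.inr (hex i h)
  obtain ⟨i, hi0, hiy⟩ := hex
  have hupd : ∀ v, v = 0 ∨ v = y →
      (∑ j, max (y - Function.update x i v j) 0) ^ 2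
        + 2 * (∑ j, max (y - Function.update x i v j) 0) * (∑ j, Function.update x i v j)
        + 2 * m * ∑ j, Function.update x i v j ^ 2
      ≤ (1 + lam) * m * (∑ j, max (Function.update x i v j) y ^ 2
        + ∑ j, Function.update x i v j ^ 2) := by
    intro v hv
    refine ih _ ?_ _ ?_ rfl
    · rw [← hc]
      refine card_lt_card ⟨fun j => ?_, fun h => ?_⟩
      · simp only [mem_filter, mem_univ, true_and]
        rcases eq_or_ne j i with rfl | hj
        · exact fun _ => ⟨hi0, hiy⟩
        · simp [Function.update_of_ne hj]
      · have := h (mem_filter.2 ⟨mem_univ i, hi0, hiy⟩)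
        simp only [mem_filter, mem_univ, true_and, Function.update_self] at this
        rcases hv with rfl | rfl <;> linarith [this.1, this.2]
    · intro j
      rcases eq_or_ne j i with rfl | hj
      · rcases hv with rfl | rfl <;> simp [hy]
      · simp [Function.update_of_ne hj, hx0]
  have hsum : ∀ (g : ℝ → ℝ) (z : Fin m → ℝ),
      ∑ j, g (z j) = g (z i) + ∑ j ∈ univ.erase i, g (z j) :=
    fun g z => (add_sum_erase _ _ (mem_univ i)).symm
  have hsum' : ∀ (g : ℝ → ℝ) (v : ℝ),
      ∑ j, g (Function.update x i v j) = g v + ∑ j ∈ univ.erase i, g (x j) := by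
    intro g v
    rw [hsum, Function.update_self]
    congr 1
    exact sum_congr rfl fun j hj => by rw [Function.update_of_ne (ne_of_mem_erase hj)]
  have h0 := hupd 0 (Or.inl rfl)
  have h1 := hupd y (Or.inr rfl)
  rw [hsum' (fun t => max (y - t) 0), hsum' (fun t => t), hsum' (fun t => t ^ 2),
    hsum' (fun t => max t y ^ 2)] at h0 h1
  rw [hsum (fun t => max (y - t) 0), hsum (fun t => t), hsum (fun t => t ^ 2),
    hsum (fun t => max t y ^ 2)]
  simp only [sub_self, max_self, sub_zero] at h0 h1
  rw [max_eq_left hy, max_eq_right hy] at h0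
  rw [max_eq_left (by linarith : 0 ≤ y - x i), max_eq_right hiy.le]
  set v := x i
  set P := ∑ j ∈ univ.erase i, max (y - x j) 0
  set X := ∑ j ∈ univ.erase i, x j
  set Q := ∑ j ∈ univ.erase i, x j ^ 2
  set R := ∑ j ∈ univ.erase i, max (x j) y ^ 2
  -- Left side minus right side is quadratic in `v` on `[0, y]` with leading coefficient `m - 1 -
  -- lam * m`, nonnegative by `hlam1`. By convexity the endpoint cases, weighted by `y - v` and `v`,
  -- suffice.
  have h2 := mul_le_mul_of_nonneg_left h0 (by linarith : 0 ≤ y - v)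
  have h3 := mul_le_mul_of_nonneg_left h1 hi0.le
  have h4 : 0 ≤ (m - 1 - lam * m) * (v * (y - v) * y) :=
    mul_nonneg (by linarith)
      (mul_nonneg (mul_nonneg hi0.le (by linarith)) hy)
  refine le_of_mul_le_mul_left ?_ (hi0.trans hiy)
  linear_combination h2 + h3 + h4

theorem exists_water_level {m : ℕ} (x : Fin m → ℝ) (hx0 : ∀ i, 0 ≤ x i) {L : ℝ} (hL : 0 ≤ L) :
    ∃ y, 0 ≤ y ∧ ∑ i, max (y - x i) 0 = m * L := by
  have hX : 0 ≤ ∑ i, x i := sum_nonneg fun i _ => hx0 i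
  have hcont : ContinuousOn (fun y => ∑ i, max (y - x i) 0) (Set.Icc 0 (L + ∑ i, x i)) := by
    fun_prop
  have h0 : ∑ i, max (0 - x i) 0 = 0 :=
    sum_eq_zero fun i _ => max_eq_right (by linarith [hx0 i])
  have h1 : m * L ≤ ∑ i, max (L + ∑ j, x j - x i) 0 := by
    have : ∑ _i : Fin m, L = m * L := by simp
    rw [← this]
    refine sum_le_sum fun i _ => le_max_of_le_left ?_
    have := single_le_sum (fun j _ => hx0 j) (mem_univ i)
    linarith
  obtain ⟨y, hy, hy'⟩ := intermediate_value_Icc (by linarith) hcont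
    (show m * L ∈ Set.Icc _ _ from ⟨by simp only [h0]; positivity, h1⟩)
  exact ⟨y, hy.1, hy'⟩

/-- Applied to the jobs on one machine of the competing schedule: a job longer than the level `y`
forces that machine's load above `y` by at least the sum of all such excesses. -/
theorem sum_sq_excess_le {ι : Type*} (A : Finset ι) (q : ι → ℝ) (hq : ∀ j, 0 ≤ q j) {y : ℝ}
    (hy : 0 ≤ y) : ∑ j ∈ A, max (q j - y) 0 ^ 2 ≤ (∑ j ∈ A, q j - y) ^ 2 := by
  classical
  by_cases h : ∃ j ∈ A, y < q j
  · have h1 : ∑ j ∈ A, max (q j - y) 0 ≤ ∑ j ∈ A, q j - y := by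
      obtain ⟨a, ha, hay⟩ := h
      rw [← add_sum_erase _ _ ha, ← add_sum_erase A q ha, max_eq_left (by linarith)]
      have : ∑ j ∈ A.erase a, max (q j - y) 0 ≤ ∑ j ∈ A.erase a, q j :=
        sum_le_sum fun j _ => max_le (by linarith) (hq j)
      linarith
    have h2 : ∑ j ∈ A, max (q j - y) 0 ^ 2 ≤ (∑ j ∈ A, max (q j - y) 0) ^ 2 :=
      sum_sq_le_sq_sum_of_nonneg fun j _ => le_max_right _ _
    exact h2.trans (pow_le_pow_left₀ (sum_nonneg fun j _ => le_max_right _ _) h1 2)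
  · push Not at h
    rw [sum_eq_zero fun j hj => by rw [max_eq_right (by linarith [h j hj])]; ring]
    exact sq_nonneg _

/-- The performance bound for jobs with unit ratios. -/
theorem sum_mul_completion_le {n m : ℕ} (hm : 0 < m) {lam : ℝ} (hlam : 0 ≤ lam)
    (hlam1 : lam * m + 1 ≤ m)
    (hk : ∀ k : ℕ, k ≤ m → (k : ℝ) * (m - k) ≤ 2 * lam ^ 2 * m ^ 2 + 2 * lam * m * k)
    (q : Fin n → ℝ) (hq : ∀ j, 0 < q j) (f f' : Fin n → Fin m) (C s : Fin n → ℝ)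
    (hC : ∀ l, C l = load q f l.val (f l) + q l)
    (hf : ∀ l i, load q f l.val (f l) ≤ load q f l.val i) (hs : ∀ j, 0 ≤ s j)
    (hf' : ∀ j j', j ≠ j' → f' j = f' j' → s j + q j ≤ s j' ∨ s j' + q j' ≤ s j)
    {K : ℕ} (hK : K ≤ n) :
    ∑ l : Fin n with l.val < K, q l * C l
      ≤ (1 + lam) * ∑ l : Fin n with l.val < K, q l * (s l + q l) := by
  have hA := two_mul_sum_mul_completion q f C hC hK
  have hB := sum_load_sq_add_le q s f' hq hs hf' K
  have hq0 : ∀ l, 0 ≤ q l := fun l => (hq l).le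
  have hmR : (0 : ℝ) < m := by exact_mod_cast hm
  have : Nonempty (Fin m) := ⟨⟨0, hm⟩⟩
  obtain ⟨i₀, hi₀⟩ := Finite.exists_min (load q f K)
  set L := load q f K i₀ with hLdef
  have hL : 0 ≤ L := load_nonneg q f hq0 K i₀
  set x : Fin m → ℝ := fun i => load q f K i - L with hx
  have hx0 : ∀ i, 0 ≤ x i := fun i => sub_nonneg.2 (hi₀ i)
  obtain ⟨y, hy, hP⟩ := exists_water_level x hx0 hL
  have hW := water_filling_bound hlam hlam1 hk hy x hx0
  have hbig : ∀ i, 0 < x i → ∃ l : Fin n, l.val < K ∧ f l = i ∧ x i ≤ q l := by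
    intro i hi
    obtain ⟨l, h1, h2, h3⟩ := exists_job_of_load_lt q f hq0 hf hK i i₀ (sub_pos.1 hi)
    exact ⟨l, h1, h2, by simp only [hx]; linarith⟩
  -- Positive excesses are dominated by jobs on distinct machines, hence by distinct jobs.
  have hfib : ∀ g : ℝ → ℝ, (∀ t, 0 ≤ g t) → g 0 = 0 → (∀ s t, 0 ≤ s → s ≤ t → g s ≤ g t) →
      ∑ i, g (x i) ≤ ∑ l : Fin n with l.val < K, g (q l) := by
    intro g hg hg0 hgm
    have : ∑ l : Fin n with l.val < K, g (q l)
        = ∑ i, ∑ l : Fin n with l.val < K, if f l = i then g (q l) else 0 := by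
      rw [sum_comm]; simp
    rw [this]
    refine sum_le_sum fun i _ => ?_
    have hnn : ∀ l ∈ univ.filter (fun l : Fin n => l.val < K),
        0 ≤ if f l = i then g (q l) else 0 := fun l _ => by split_ifs <;> simp [hg]
    rcases (hx0 i).eq_or_lt with h | h
    · rw [← h, hg0]
      exact sum_nonneg hnn
    · obtain ⟨l, h1, h2, h3⟩ := hbig i h
      refine (hgm _ _ h.le h3).trans ?_
      have := single_le_sum hnn (mem_filter.2 ⟨mem_univ l, h1⟩)
      simpa [h2] using this
  have hQ : ∑ i, x i ^ 2 ≤ ∑ l : Fin n with l.val < K, q l ^ 2 :=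
    hfib (fun t => t ^ 2) (fun t => sq_nonneg t) (by simp)
      fun s t h0 h => pow_le_pow_left₀ h0 h 2
  have hE : ∑ i, max (x i - y) 0 ^ 2 ≤ ∑ i, (load q f' K i - y) ^ 2 := by
    refine (hfib (fun t => max (t - y) 0 ^ 2) (fun t => sq_nonneg _) ?_ ?_).trans ?_
    · simp [hy]
    · intro s t _ h
      exact pow_le_pow_left₀ (le_max_right _ _) (max_le_max (by linarith) le_rfl) 2
    · have : ∑ l : Fin n with l.val < K, max (q l - y) 0 ^ 2
          = ∑ i, ∑ l : Fin n with l.val < K, if f' l = i then max (q l - y) 0 ^ 2 else 0 := by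
        rw [sum_comm]; simp
      rw [this]
      refine sum_le_sum fun i _ => ?_
      rw [load]
      simp only [← sum_filter (s := filter _ _)]
      exact sum_sq_excess_le _ q hq0 hy
  have hT : ∑ i, load q f' K i = m * L + ∑ i, x i := by
    rw [sum_load, ← sum_load q f]
    simp [hx]
  have hR : ∑ i, max (x i) y ^ 2
      = ∑ i, max (x i - y) 0 ^ 2 + 2 * y * (m * L + ∑ i, x i) - m * y ^ 2 := by
    have : ∀ i, max (x i) y ^ 2
        = max (x i - y) 0 ^ 2 + 2 * y * (x i + max (y - x i) 0) - y ^ 2 := by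
      intro i
      rcases le_total (x i) y with h | h
      · rw [max_eq_right h, max_eq_left (by linarith : 0 ≤ y - x i),
          max_eq_right (by linarith : x i - y ≤ 0)]
        ring
      · rw [max_eq_left h, max_eq_right (by linarith : y - x i ≤ 0),
          max_eq_left (by linarith : 0 ≤ x i - y)]
        ring
    rw [sum_congr rfl fun i _ => this i, sum_sub_distrib, sum_add_distrib, ← mul_sum,
      sum_add_distrib, hP, sum_const, card_univ, Fintype.card_fin, nsmul_eq_mul]
    ring
  have hN : ∑ i, (load q f' K i - y) ^ 2
      = ∑ i, load q f' K i ^ 2 - 2 * y * (m * L + ∑ i, x i) + m * y ^ 2 := by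
    rw [← hT, mul_sum, ← sum_sub_distrib]
    have : (m : ℝ) * y ^ 2 = ∑ _i : Fin m, y ^ 2 := by simp
    rw [this, ← sum_add_distrib]
    exact sum_congr rfl fun i _ => by ring
  have hM : ∑ i, load q f K i ^ 2 = m * L ^ 2 + 2 * L * ∑ i, x i + ∑ i, x i ^ 2 := by
    have : (m : ℝ) * L ^ 2 = ∑ _i : Fin m, L ^ 2 := by simp
    rw [this, mul_sum, ← sum_add_distrib, ← sum_add_distrib]
    exact sum_congr rfl fun i _ => by simp only [hx]; ring
  have hW' : m * L ^ 2 + 2 * L * ∑ i, x i + 2 * ∑ i, x i ^ 2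
      ≤ (1 + lam) * (∑ i, max (x i) y ^ 2 + ∑ i, x i ^ 2) := by
    rw [hP] at hW
    refine le_of_mul_le_mul_left ?_ hmR
    linarith
  -- Both configurations have the same total, so comparing squares is the same as comparing squared
  -- deviations from `y`, which is `hE`.
  have hRN : ∑ i, max (x i) y ^ 2 ≤ ∑ i, load q f' K i ^ 2 := by linarith
  have h1 := mul_le_mul_of_nonneg_left hRN (by linarith : 0 ≤ 1 + lam)
  have h2 := mul_le_mul_of_nonneg_left hQ hlam
  have h3 := mul_le_mul_of_nonneg_left hB (by linarith : 0 ≤ 1 + lam)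
  linarith

/-- The performance bound for the WSPT rule against an arbitrary schedule. -/
theorem Schedule.IsWSPT.cost_le {n m : ℕ} (hm : 0 < m) {lam : ℝ} (hlam : 0 ≤ lam)
    (hlam1 : lam * m + 1 ≤ m)
    (hk : ∀ k : ℕ, k ≤ m → (k : ℝ) * (m - k) ≤ 2 * lam ^ 2 * m ^ 2 + 2 * lam * m * k)
    {I : JobSet n} {S : Schedule I m} (hS : S.IsWSPT) (S' : Schedule I m) :
    S.cost ≤ (1 + lam) * S'.cost := by
  obtain ⟨π, hπ, hlist⟩ := hS
  have hload : ∀ k i, S.loadBefore π k i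
      = load (fun l => I.p (π l)) (fun l => S.machine (π l)) k.val i := by
    intro k i
    rw [load_eq_sum]
    rfl
  have key := sum_mul_nonneg_of_antitone (fun l => I.w (π l) / I.p (π l))
    (fun l => I.p (π l) * ((1 + lam) * S'.completion (π l) - S.completion (π l))) hπ
    (fun l => (div_pos (I.w_pos _) (I.p_pos _)).le) ?_
  · have : ∀ l, I.w (π l) / I.p (π l)
          * (I.p (π l) * ((1 + lam) * S'.completion (π l) - S.completion (π l)))
        = (1 + lam) * (I.w (π l) * S'.completion (π l)) - I.w (π l) * S.completion (π l) := by
      intro l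
      have := (I.p_pos (π l)).ne'
      field_simp
    rw [sum_congr rfl fun l _ => this l, sum_sub_distrib, ← mul_sum,
      Equiv.sum_comp π (fun j => I.w j * S'.completion j),
      Equiv.sum_comp π (fun j => I.w j * S.completion j)] at key
    simp only [Schedule.cost]
    linarith
  · intro K hK
    have h := sum_mul_completion_le hm hlam hlam1 hk (fun l => I.p (π l)) (fun l => I.p_pos _)
      (fun l => S.machine (π l)) (fun l => S'.machine (π l)) (fun l => S.completion (π l))
      (fun l => S'.start (π l))
      (fun l => by rw [← hload, ← (hlist l).2]; rfl)
      (fun l i => by rw [← hload, ← hload]; exact (hlist l).1 i)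
      (fun l => S'.start_nonneg _)
      (fun j j' hne he => S'.no_overlap _ _ (π.injective.ne hne) he) hK
    have h' : ∀ l, I.p (π l) * ((1 + lam) * S'.completion (π l) - S.completion (π l))
        = (1 + lam) * (I.p (π l) * (S'.start (π l) + I.p (π l)))
          - I.p (π l) * S.completion (π l) := by
      intro l
      simp only [Schedule.completion]
      ring
    rw [sum_congr rfl fun l _ => h' l, sum_sub_distrib, ← mul_sum]
    linarith

/-! ### The constant -/

/-- Among the integers `j ≤ m`, an integer `c` within `1 / 2` of `m / √2` maximizes
`√(m ^ 2 - j ^ 2) + j`. -/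
theorem nearest_maximizes {m c j : ℕ} (hm : j ≤ m) (h1 : (m : ℝ) ^ 2 ≤ 2 * (c + 1 / 2) ^ 2)
    (h2 : 0 < c → 2 * ((c : ℝ) - 1 / 2) ^ 2 ≤ m ^ 2) :
    √((m : ℝ) ^ 2 - j ^ 2) + j ≤ √((m : ℝ) ^ 2 - c ^ 2) + c := by
  have hj : (0 : ℝ) ≤ (m : ℝ) ^ 2 - j ^ 2 := by
    have : (j : ℝ) ≤ m := by exact_mod_cast hm
    nlinarith [j.cast_nonneg (α := ℝ)]
  set s := √((m : ℝ) ^ 2 - j ^ 2)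
  have hs : s ^ 2 = (m : ℝ) ^ 2 - j ^ 2 := Real.sq_sqrt hj
  have hs0 : 0 ≤ s := Real.sqrt_nonneg _
  have key : 0 ≤ ((j : ℝ) - c) * (c - s) := by
    rcases lt_trichotomy j c with h | rfl | h
    · have hjc : (j : ℝ) + 1 ≤ c := by exact_mod_cast h
      -- Integrality improves the `1 / 2` left over from `h2` to the `1` needed below.
      have hint : 2 * c * c + 1 ≤ m ^ 2 + 2 * c := by
        have h3 := h2 (by omega)
        have h4 : 2 * c * c < m ^ 2 + 2 * c := by
          have : (2 * c * c : ℝ) < m ^ 2 + 2 * c := by nlinarith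
          exact_mod_cast this
        omega
      have hint' : (2 * c * c + 1 : ℝ) ≤ m ^ 2 + 2 * c := by exact_mod_cast hint
      have : (c : ℝ) ≤ s := by
        refine Real.le_sqrt_of_sq_le ?_
        nlinarith [j.cast_nonneg (α := ℝ)]
      exact mul_nonneg_of_nonpos_of_nonpos (by linarith) (by linarith)
    · simp
    · have hjc : (c : ℝ) + 1 ≤ j := by exact_mod_cast h
      have : s ≤ c := by
        refine Real.sqrt_le_iff.2 ⟨c.cast_nonneg, ?_⟩
        nlinarith [c.cast_nonneg (α := ℝ)]
      exact mul_nonneg (by linarith) (by linarith)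
  have : s + j - c ≤ √((m : ℝ) ^ 2 - c ^ 2) := by
    refine Real.le_sqrt_of_sq_le ?_
    nlinarith
  linarith

theorem sqrt_two_bounds : 1.414 < √2 ∧ √2 < 1.415 :=
  ⟨Real.lt_sqrt_of_sq_lt (by norm_num), (Real.sqrt_lt' (by norm_num)).2 (by norm_num)⟩

theorem exists_nearestK {m : ℕ} (hm : 1 ≤ m) :
    ∃ k : ℕ, nearestK m = k ∧ k < m ∧ |(1 - √2 / 2) * (m : ℝ) - k| ≤ 1 / 2 := by
  obtain ⟨h1, h2⟩ := sqrt_two_bounds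
  have hmR : (1 : ℝ) ≤ m := by exact_mod_cast hm
  have hr : |(1 - √2 / 2) * (m : ℝ) - (nearestK m : ℤ)| ≤ 1 / 2 := abs_sub_round _
  have ha := abs_le.1 hr
  have h0 : 0 ≤ nearestK m := by
    have : (-1 : ℝ) < (nearestK m : ℤ) := by nlinarith
    have : -1 < nearestK m := by exact_mod_cast this
    omega
  obtain ⟨k, hk⟩ := Int.eq_ofNat_of_zero_le h0
  rw [hk] at hr ha
  simp only [Int.cast_natCast] at hr ha
  refine ⟨k, hk, ?_, hr⟩
  have : (k : ℝ) < m := by nlinarith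
  exact_mod_cast this

theorem wsptRatio_eq {m k : ℕ} (hk : nearestK m = k) :
    wsptRatio m = 1 + (√((2 * (m : ℝ) - k) * k) - k) / (2 * m) := by
  rw [wsptRatio, hk]
  simp only [Int.cast_natCast]
  rcases Nat.eq_zero_or_pos m with rfl | h
  · simp
  · field_simp

/-- Substituting `j = m - k` turns the radicand into `m ^ 2 - j ^ 2`, the form of
`nearest_maximizes`. -/
theorem le_wsptRatio_excess {m k : ℕ} (hk : k < m) (hr : |(1 - √2 / 2) * (m : ℝ) - k| ≤ 1 / 2)
    {k' : ℕ} (hk' : k' ≤ m) :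
    √((2 * (m : ℝ) - k') * k') - k' ≤ √((2 * (m : ℝ) - k) * k) - k := by
  obtain ⟨ha, hb⟩ := abs_le.1 hr
  have hs : √2 ^ 2 = 2 := Real.sq_sqrt (by norm_num)
  have h2 := Real.sqrt_nonneg 2
  have hm0 : (0 : ℝ) ≤ m := m.cast_nonneg
  have hc : ((m - k : ℕ) : ℝ) = m - k := by push_cast [hk.le]; ring
  have hj : ((m - k' : ℕ) : ℝ) = m - k' := by push_cast [hk']; ring
  have hsm : (√2 / 2 * m) ^ 2 * 2 = (m : ℝ) ^ 2 := by
    rw [mul_pow, div_pow, hs]; ring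
  have hsm0 : 0 ≤ √2 / 2 * m := by positivity
  have h1m : (1 : ℝ) ≤ m - k := by
    have : (k : ℝ) + 1 ≤ m := by exact_mod_cast hk
    linarith
  have := nearest_maximizes (m := m) (c := m - k) (j := m - k') (Nat.sub_le _ _)
    (by rw [hc]; nlinarith) (fun _ => by rw [hc]; nlinarith)
  rw [hc, hj] at this
  have e1 : (m : ℝ) ^ 2 - (m - k) ^ 2 = (2 * m - k) * k := by ring
  have e2 : (m : ℝ) ^ 2 - (m - k') ^ 2 = (2 * m - k') * k' := by ring
  rw [e1, e2] at this
  linarith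

theorem wsptRatio_rate {m : ℕ} (hm : 1 ≤ m) :
    0 ≤ 1 / 2 * (1 + √2) - wsptRatio m ∧ 1 / 2 * (1 + √2) - wsptRatio m ≤ 2 / (m : ℝ) ^ 2 := by
  obtain ⟨k, hk, hkm, hr⟩ := exists_nearestK hm
  rw [wsptRatio_eq hk]
  obtain ⟨ha, hb⟩ := abs_le.1 hr
  have hs : √2 ^ 2 = 2 := Real.sq_sqrt (by norm_num)
  obtain ⟨hs1, hs2⟩ := sqrt_two_bounds
  have hmR : (1 : ℝ) ≤ m := by exact_mod_cast hm
  have hkm' : (k : ℝ) ≤ m := by exact_mod_cast hkm.le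
  -- `u` is the tangent at the real maximizer `(1 - √2 / 2) * m`, so the error is quadratic in the
  -- rounding error `d`.
  set u := (√2 - 1) * m + k with hu
  set d := (1 - √2 / 2) * (m : ℝ) - k with hd
  have hu0 : m / 5 ≤ u := by nlinarith
  have hd2 : d ^ 2 ≤ 1 / 4 := by nlinarith
  have hrad : (2 * (m : ℝ) - k) * k = u ^ 2 - 2 * d ^ 2 := by
    rw [hu, hd]
    linear_combination (- m ^ 2 / 2 : ℝ) * hs
  have hnn : 0 ≤ (2 * (m : ℝ) - k) * k :=
    mul_nonneg (by linarith) k.cast_nonneg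
  rw [hrad] at hnn ⊢
  have hup : √(u ^ 2 - 2 * d ^ 2) ≤ u :=
    Real.sqrt_le_iff.2 ⟨by linarith, by nlinarith [sq_nonneg d]⟩
  have hupos : 0 < u := by linarith
  have hlow : u - 2 * d ^ 2 / u ≤ √(u ^ 2 - 2 * d ^ 2) := by
    refine Real.le_sqrt_of_sq_le ?_
    have e : (u - 2 * d ^ 2 / u) ^ 2
        = u ^ 2 - 2 * d ^ 2 - 2 * d ^ 2 * (u ^ 2 - 2 * d ^ 2) / u ^ 2 := by
      field_simp
    rw [e]
    have : 0 ≤ 2 * d ^ 2 * (u ^ 2 - 2 * d ^ 2) / u ^ 2 := by positivity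
    linarith
  have hbd : 2 * d ^ 2 / u ≤ 4 / m := by
    rw [div_le_div_iff₀ hupos (by linarith)]
    nlinarith
  have e : 1 / 2 * (1 + √2) - (1 + (√(u ^ 2 - 2 * d ^ 2) - k) / (2 * m))
      = (u - √(u ^ 2 - 2 * d ^ 2)) / (2 * m) := by
    rw [hu]
    field_simp
    ring
  rw [e]
  refine ⟨div_nonneg (by linarith) (by linarith), ?_⟩
  have e2 : 2 / (m : ℝ) ^ 2 = (4 / m) / (2 * m) := by
    field_simp
    norm_num
  rw [e2]
  exact div_le_div_of_nonneg_right (by linarith) (by linarith)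

theorem one_le_wsptRatio {m : ℕ} (hm : 1 ≤ m) : 1 ≤ wsptRatio m := by
  obtain ⟨k, hk, hkm, hr⟩ := exists_nearestK hm
  have h := le_wsptRatio_excess hkm hr (Nat.zero_le m)
  rw [wsptRatio_eq hk]
  simp only [Nat.cast_zero, mul_zero, Real.sqrt_zero, sub_zero] at h
  have : 0 ≤ (√((2 * (m : ℝ) - k) * k) - k) / (2 * m) := div_nonneg h (by positivity)
  linarith

theorem wsptRatio_excess_mul_add_one_le {m : ℕ} (hm : 1 ≤ m) :
    (wsptRatio m - 1) * m + 1 ≤ m := by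
  obtain ⟨hs1, hs2⟩ := sqrt_two_bounds
  rcases hm.eq_or_lt with rfl | hm'
  · obtain ⟨k, hk, hkm, hr⟩ := exists_nearestK le_rfl
    obtain rfl : k = 0 := by omega
    rw [wsptRatio_eq hk]
    simp
  · have h := (wsptRatio_rate hm).1
    have : (2 : ℝ) ≤ m := by exact_mod_cast hm'
    nlinarith

/-- This is the maximality of `k` with the square root cleared by squaring. -/
theorem mul_sub_le_of_wsptRatio {m : ℕ} (hm : 1 ≤ m) (k' : ℕ) (hk' : k' ≤ m) :
    (k' : ℝ) * (m - k')
      ≤ 2 * (wsptRatio m - 1) ^ 2 * m ^ 2 + 2 * (wsptRatio m - 1) * m * k' := by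
  obtain ⟨k, hk, hkm, hr⟩ := exists_nearestK hm
  have h := le_wsptRatio_excess hkm hr hk'
  have hmR : (0 : ℝ) < m := by exact_mod_cast hm
  have hk'R : (k' : ℝ) ≤ m := by exact_mod_cast hk'
  have e : √((2 * (m : ℝ) - k) * k) - k = 2 * m * (wsptRatio m - 1) := by
    rw [wsptRatio_eq hk]
    field_simp
    ring
  rw [e] at h
  have hnn : 0 ≤ (2 * (m : ℝ) - k') * k' := mul_nonneg (by linarith) k'.cast_nonneg
  have h2 := pow_le_pow_left₀ (Real.sqrt_nonneg _) (by linarith :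
    √((2 * (m : ℝ) - k') * k') ≤ 2 * m * (wsptRatio m - 1) + k') 2
  rw [Real.sq_sqrt hnn] at h2
  nlinarith

theorem Schedule.IsWSPT.cost_le_wsptRatio_mul_optCost {n m : ℕ} (hm : 1 ≤ m) {I : JobSet n}
    {S : Schedule I m} (hS : S.IsWSPT) : S.cost ≤ wsptRatio m * optCost I m := by
  have h1 := one_le_wsptRatio hm
  have h0 : 0 < wsptRatio m := by linarith
  have : Nonempty (Schedule I m) := ⟨S⟩
  rw [mul_comm, ← div_le_iff₀ h0]
  refine le_ciInf fun S' => ?_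
  rw [div_le_iff₀ h0, mul_comm]
  have := hS.cost_le hm (lam := wsptRatio m - 1) (by linarith)
    (wsptRatio_excess_mul_add_one_le hm) (mul_sub_le_of_wsptRatio hm) S'
  simpa using this

/-! ### Tightness -/

/-- The schedule without idle times where machine `f l` processes job `l`, in the order of the
indices. -/
noncomputable def listSchedule {n m : ℕ} (I : JobSet n) (f : Fin n → Fin m) : Schedule I m where
  machine := f
  start l := load I.p f l.val (f l)
  start_nonneg l := load_nonneg _ _ (fun j => (I.p_pos j).le) _ _
  no_overlap := by
    have key : ∀ j j' : Fin n, j < j' → f j = f j' →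
        load I.p f j.val (f j) + I.p j ≤ load I.p f j'.val (f j') := by
      intro j j' hlt he
      have h := load_mono I.p f (fun j => (I.p_pos j).le) (Nat.succ_le_of_lt hlt) (f j)
      rw [Nat.succ_eq_add_one, load_succ _ _ j.isLt, if_pos rfl] at h
      rwa [← he]
    intro j j' hne he
    rcases lt_or_gt_of_ne hne with h | h
    · exact Or.inl (key j j' h he)
    · exact Or.inr (key j' j h he.symm)

theorem two_mul_cost_listSchedule {n m : ℕ} (I : JobSet n) (hI : I.w = I.p) (f : Fin n → Fin m) :
    2 * (listSchedule I f).cost = ∑ i, load I.p f n i ^ 2 + ∑ l, I.p l ^ 2 := by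
  have h := two_mul_sum_mul_completion I.p f (listSchedule I f).completion (fun l => rfl) le_rfl
  rw [sum_val_lt_self] at h
  rw [sum_val_lt_self] at h
  rw [← h, Schedule.cost, hI]

theorem isWSPT_listSchedule {n m : ℕ} (I : JobSet n) (hI : I.w = I.p) (f : Fin n → Fin m)
    (hf : ∀ l i, load I.p f l.val (f l) ≤ load I.p f l.val i) : (listSchedule I f).IsWSPT := by
  have hload : ∀ k i, (listSchedule I f).loadBefore (Equiv.refl _) k i = load I.p f k.val i :=
    fun k i => (load_eq_sum I.p f k.val i).symm
  refine ⟨Equiv.refl _, fun k l _ => ?_, fun k => ⟨fun i => ?_, ?_⟩⟩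
  · rw [hI, div_self (I.p_pos _).ne', div_self (I.p_pos _).ne']
  · rw [hload, hload]
    exact hf k i
  · rw [hload]
    rfl

theorem load_eq_count {n m : ℕ} (q : Fin n → ℝ) (f : Fin n → Fin m) (g : ℕ → ℕ) {N : ℕ}
    (hq : ∀ l, l.val < N → q l = 1) (hg : ∀ l, l.val < N → (f l).val = g l.val) (hN : N ≤ n)
    {K : ℕ} (hK : K ≤ N) (i : Fin m) :
    load q f K i = Nat.count (fun l => g l = i.val) K := by
  induction K with
  | zero => simp [load_zero]
  | succ K ih =>
    rw [load_succ q f (by omega : K < n), ih (by omega), Nat.count_succ, hq ⟨K, _⟩ hK]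
    have : f ⟨K, by omega⟩ = i ↔ g K = i.val := by
      rw [Fin.ext_iff, hg ⟨K, _⟩ hK]
    simp only [this]
    split_ifs <;> simp

theorem load_add_eq {N k m : ℕ} (q : Fin (N + k) → ℝ) (f : Fin (N + k) → Fin m) {X : ℝ}
    (hq : ∀ l, N ≤ l.val → q l = X) (hg : ∀ l, N ≤ l.val → (f l).val = l.val - N)
    {t : ℕ} (ht : t ≤ k) (i : Fin m) :
    load q f (N + t) i = load q f N i + if i.val < t then X else 0 := by
  induction t with
  | zero => simp
  | succ t ih =>
    rw [← Nat.add_assoc, load_succ q f (by omega : N + t < N + k), ih (by omega),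
      hq ⟨N + t, _⟩ (Nat.le_add_right _ _), add_assoc]
    have : f ⟨N + t, by omega⟩ = i ↔ i.val = t := by
      rw [Fin.ext_iff, hg ⟨N + t, _⟩ (Nat.le_add_right _ _)]
      simp only
      omega
    simp only [this]
    congr 1
    split_ifs <;> first | omega | simp

/-- Round robin over the `b` machines from `c` on: the quotient counts complete rounds, the
remainder the machines already served in the current one. -/
theorem count_add_mod_eq {b : ℕ} (hb : 0 < b) (c i K : ℕ) (hi : c ≤ i) (hi' : i < c + b) :
    Nat.count (fun l => c + l % b = i) K = K / b + if i - c < K % b then 1 else 0 := by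
  have h := Nat.count_modEq_card K hb (i - c)
  rw [Nat.mod_eq_of_lt (by omega : i - c < b)] at h
  rw [← h]
  congr 1
  ext l
  rw [Nat.ModEq, Nat.mod_eq_of_lt (by omega : i - c < b)]
  omega

theorem sum_ite_val_lt {m k : ℕ} (hk : k ≤ m) (c d : ℝ) :
    ∑ i : Fin m, (if i.val < k then c else d) = k * c + (m - k) * d := by
  rw [Fin.sum_univ_eq_sum_range (fun i => if i < k then c else d) m,
    ← Finset.sum_range_add_sum_Ico _ hk]
  rw [sum_congr rfl fun i hi => if_pos (mem_range.1 hi),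
    sum_congr rfl fun i hi => if_neg (not_lt.2 (mem_Ico.1 hi).1)]
  simp [hk]

/-- `N` jobs of unit length, followed by `k` jobs of length `X`, all with ratio one. -/
def twoSizes (N k : ℕ) {X : ℝ} (hX : 0 < X) : JobSet (N + k) where
  p l := if l.val < N then 1 else X
  w l := if l.val < N then 1 else X
  p_pos l := by split_ifs <;> simp [hX]
  w_pos l := by split_ifs <;> simp [hX]

/-- The number of unit jobs is divisible by both `m` and `b`, so they spread evenly over all
machines in `S` and over the last `b` in `S'`. -/
theorem exists_twoSizes_schedules {m k b : ℕ} (hm : m = k + b) (hb : 0 < b) (q : ℕ) {X : ℝ}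
    (hX : 0 < X) :
    ∃ S S' : Schedule (twoSizes (m * (b * q)) k hX) m, S.IsWSPT ∧
      2 * S.cost = m * (b * q) ^ 2 + 2 * k * (b * q) * X + 2 * k * X ^ 2 + m * (b * q) ∧
      2 * S'.cost = b * (m * q) ^ 2 + 2 * k * X ^ 2 + m * (b * q) := by
  set N := m * (b * q) with hN
  set I := twoSizes N k hX with hI
  have hm0 : 0 < m := by omega
  have hp1 : ∀ l : Fin (N + k), l.val < N → I.p l = 1 := fun l hl => if_pos hl
  have hpX : ∀ l : Fin (N + k), N ≤ l.val → I.p l = X := fun l hl => if_neg (not_lt.2 hl)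
  let f : Fin (N + k) → Fin m := fun l =>
    if l.val < N then ⟨0 + l.val % m, by rw [zero_add]; exact Nat.mod_lt _ hm0⟩
    else ⟨l.val - N, by omega⟩
  let f' : Fin (N + k) → Fin m := fun l =>
    if l.val < N then ⟨k + l.val % b, by have := Nat.mod_lt l.val hb; omega⟩
    else ⟨l.val - N, by omega⟩
  have hf1 : ∀ l : Fin (N + k), l.val < N → (f l).val = 0 + l.val % m := fun l hl => by
    simp [f, hl]
  have hf2 : ∀ l : Fin (N + k), N ≤ l.val → (f l).val = l.val - N := fun l hl => by
    simp [f, not_lt.2 hl]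
  have hf1' : ∀ l : Fin (N + k), l.val < N → (f' l).val = k + l.val % b := fun l hl => by
    simp [f', hl]
  have hf2' : ∀ l : Fin (N + k), N ≤ l.val → (f' l).val = l.val - N := fun l hl => by
    simp [f', not_lt.2 hl]
  have hload : ∀ K ≤ N, ∀ i : Fin m,
      load I.p f K i = (K / m : ℕ) + if i.val < K % m then 1 else 0 := by
    intro K hK i
    rw [load_eq_count I.p f (fun l => 0 + l % m) hp1 hf1 (Nat.le_add_right _ _) hK,
      count_add_mod_eq hm0 _ _ _ (Nat.zero_le _) (by omega)]
    push_cast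
    rfl
  have hloadN : ∀ t ≤ k, ∀ i : Fin m,
      load I.p f (N + t) i = b * q + if i.val < t then X else 0 := by
    intro t ht i
    rw [load_add_eq I.p f hpX hf2 ht, hload N le_rfl, hN, Nat.mul_mod_right,
      Nat.mul_div_cancel_left _ hm0]
    simp
  have hloadN' : ∀ i : Fin m, load I.p f' (N + k) i = if i.val < k then X else m * q := by
    intro i
    rw [load_add_eq I.p f' hpX hf2' le_rfl,
      load_eq_count I.p f' (fun l => k + l % b) hp1 hf1' (Nat.le_add_right _ _) le_rfl]
    split_ifs with h
    · have : ∀ l, ¬ k + l % b = i.val := fun l => by omega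
      simp [this, Nat.count_false]
    · have e : N = b * (m * q) := by rw [hN]; ring
      rw [count_add_mod_eq hb _ _ _ (not_lt.1 h) (by omega), e, Nat.mul_mod_right,
        Nat.mul_div_cancel_left _ hb]
      simp
  have hsq : ∑ l, I.p l ^ 2 = m * (b * q) + k * X ^ 2 := by
    have : ∀ l : Fin (N + k), I.p l ^ 2 = if l.val < N then 1 else X ^ 2 := by
      intro l
      split_ifs with h
      · rw [hp1 l h, one_pow]
      · rw [hpX l (not_lt.1 h)]
    rw [sum_congr rfl fun l _ => this l, sum_ite_val_lt (Nat.le_add_right _ _), hN]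
    push_cast
    ring
  have hmb : (m : ℝ) = k + b := by rw [hm]; push_cast; rfl
  refine ⟨listSchedule I f, listSchedule I f', isWSPT_listSchedule I rfl f ?_, ?_, ?_⟩
  · intro l i
    rcases lt_or_ge l.val N with h | h
    · rw [hload _ h.le, hload _ h.le, hf1 l h, zero_add, if_neg (lt_irrefl _)]
      split_ifs <;> simp
    · obtain ⟨t, ht⟩ := Nat.exists_eq_add_of_le h
      have htk : t ≤ k := by omega
      rw [ht, hloadN t htk, hloadN t htk, hf2 l h, ht, Nat.add_sub_cancel_left,
        if_neg (lt_irrefl _)]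
      split_ifs <;> simp [hX.le]
  · rw [two_mul_cost_listSchedule I rfl, hsq]
    have : ∀ i : Fin m, load I.p f (N + k) i ^ 2
        = if i.val < k then (b * q + X) ^ 2 else (b * q : ℝ) ^ 2 := by
      intro i
      rw [hloadN k le_rfl]
      split_ifs <;> simp
    rw [sum_congr rfl fun i _ => this i, sum_ite_val_lt (by omega), hmb]
    ring
  · rw [two_mul_cost_listSchedule I rfl, hsq]
    have : ∀ i : Fin m, load I.p f' (N + k) i ^ 2
        = if i.val < k then X ^ 2 else (m * q : ℝ) ^ 2 := by
      intro i
      rw [hloadN']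
      split_ifs <;> rfl
    rw [sum_congr rfl fun i _ => this i, sum_ite_val_lt (by omega), hmb]
    ring

/-- The relative length of the long jobs in the worst-case instances. -/
theorem exists_worst_length {m k b : ℕ} (hm : m = k + b) (hb : 0 < b) (hk : nearestK m = k) :
    ∃ u : ℝ, 0 < u ∧ m * (b : ℝ) ^ 2 + 2 * k * b * (u * m) + 2 * k * (u * m) ^ 2
      = wsptRatio m * (b * m ^ 2 + 2 * k * (u * m) ^ 2) := by
  have hmR : (m : ℝ) = k + b := by rw [hm]; push_cast; rfl
  have hbR : (0 : ℝ) < b := by exact_mod_cast hb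
  have hmpos : (0 : ℝ) < m := by rw [hmR]; positivity
  rw [wsptRatio_eq hk]
  rcases Nat.eq_zero_or_pos k with rfl | hk0
  · refine ⟨1, one_pos, ?_⟩
    have : (b : ℝ) = m := by rw [hmR]; simp
    simp [this]
  · have hkR : (0 : ℝ) < k := by exact_mod_cast hk0
    have hnn : 0 ≤ (2 * (m : ℝ) - k) * k := by
      rw [hmR]
      exact mul_nonneg (by linarith) hkR.le
    set r := √((2 * (m : ℝ) - k) * k)
    have hr : r ^ 2 = (2 * (m : ℝ) - k) * k := Real.sq_sqrt hnn
    have hr0 : 0 ≤ r := Real.sqrt_nonneg _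
    -- A root of the quadratic equation in `u`; `r` is the square root in `ρ_m`.
    refine ⟨(k + r) / (2 * k), by positivity, ?_⟩
    have hb' : (b : ℝ) = m - k := by linarith
    rw [hb']
    field_simp
    have h3 : r ^ 3 = (2 * (m : ℝ) - k) * k * r := by rw [← hr]; ring
    ring_nf
    ring_nf at hr h3
    simp only [hr, h3]
    ring

theorem exists_isWSPT_le_div {m : ℕ} (hm : 1 ≤ m) {ε : ℝ} (hε : 0 < ε) :
    ∃ (n : ℕ) (I : JobSet n) (S : Schedule I m),
      S.IsWSPT ∧ 0 < optCost I m ∧ wsptRatio m - ε ≤ S.cost / optCost I m := by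
  obtain ⟨k, hk, hkm, -⟩ := exists_nearestK hm
  obtain ⟨b, hmb⟩ := Nat.exists_eq_add_of_le hkm.le
  have hb : 0 < b := by omega
  obtain ⟨u, hu, hAB⟩ := exists_worst_length hmb hb hk
  have hmR : (1 : ℝ) ≤ m := by exact_mod_cast hm
  have hbR : (0 : ℝ) < b := by exact_mod_cast hb
  have hρ := one_le_wsptRatio hm
  -- The costs are quadratic in `q` up to the common term `m * b * q`, which a large `q` makes
  -- negligible.
  obtain ⟨q, hq⟩ := exists_nat_gt (wsptRatio m / ε)
  rw [div_lt_iff₀ hε] at hq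
  have hq0 : (0 : ℝ) < q := by
    by_contra! h
    nlinarith
  have hX : 0 < u * m * q := by positivity
  obtain ⟨S, S', hS, hc, hc'⟩ := exists_twoSizes_schedules hmb hb q hX
  have hSpos : 0 < S.cost := by
    have : 0 < m * (b * q : ℝ) ^ 2 + 2 * k * (b * q) * (u * m * q) + 2 * k * (u * m * q) ^ 2
        + m * (b * q) := by positivity
    linarith
  have hub := hS.cost_le_wsptRatio_mul_optCost hm
  -- The upper bound already proved makes the infimum positive.
  have hopt : 0 < optCost (twoSizes (m * (b * q)) k hX) m :=
    pos_of_mul_pos_right (hSpos.trans_le hub) (by linarith)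
  refine ⟨_, _, S, hS, hopt, ?_⟩
  rw [le_div_iff₀ hopt]
  have hle : optCost (twoSizes (m * (b * q)) k hX) m ≤ S'.cost := by
    refine ciInf_le ⟨0, ?_⟩ S'
    rintro _ ⟨T, rfl⟩
    exact sum_nonneg fun j _ => mul_nonneg (JobSet.w_pos _ j).le
      (add_nonneg (T.start_nonneg j) (JobSet.p_pos _ j).le)
  rcases le_total (wsptRatio m - ε) 0 with h | h
  · exact (mul_nonpos_of_nonpos_of_nonneg h hopt.le).trans hSpos.le
  refine (mul_le_mul_of_nonneg_left hle h).trans ?_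
  have e1 : 2 * S.cost
      = q ^ 2 * (wsptRatio m * (b * m ^ 2 + 2 * k * (u * m) ^ 2)) + m * b * q := by
    rw [hc, ← hAB]; ring
  have e2 : 2 * S'.cost = q ^ 2 * (b * m ^ 2 + 2 * k * (u * m) ^ 2) + m * b * q := by
    rw [hc']; ring
  have h1 : wsptRatio m * (m * b * q) ≤ ε * (q ^ 2 * (b * m ^ 2)) := by
    have : wsptRatio m ≤ q * ε * m := by nlinarith
    have h2 := mul_le_mul_of_nonneg_right this (by positivity : (0 : ℝ) ≤ m * b * q)
    linarith
  have h2 : 0 ≤ ε * (q ^ 2 * (2 * k * (u * m) ^ 2)) := by positivity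
  have h3 : 0 ≤ m * b * (q : ℝ) := by positivity
  have h4 : 0 ≤ ε * (m * b * (q : ℝ)) := by positivity
  nlinarith

end ParallelScheduling

theorem mainTheorem3 :
    -- performance ratio and tightness, for every fixed number of machines
    (∀ m : ℕ, 1 ≤ m →
      (∀ (n : ℕ) (I : ParallelScheduling.JobSet n) (S : ParallelScheduling.Schedule I m),
        S.IsWSPT →
          S.cost ≤ ParallelScheduling.wsptRatio m * ParallelScheduling.optCost I m) ∧
      (∀ ε : ℝ, 0 < ε →
        ∃ (n : ℕ) (I : ParallelScheduling.JobSet n) (S : ParallelScheduling.Schedule I m),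
          S.IsWSPT ∧ 0 < ParallelScheduling.optCost I m ∧
          ParallelScheduling.wsptRatio m - ε ≤ S.cost / ParallelScheduling.optCost I m)) ∧
    -- the ratio is `(1 + √2) / 2 - O(1 / m ^ 2)`
    (∃ C : ℝ, ∀ m : ℕ, 1 ≤ m →
      0 ≤ 1 / 2 * (1 + √2) - ParallelScheduling.wsptRatio m ∧
      1 / 2 * (1 + √2) - ParallelScheduling.wsptRatio m ≤ C / (m : ℝ) ^ 2) :=
  ⟨fun _ hm => ⟨fun _ _ _ hS => hS.cost_le_wsptRatio_mul_optCost hm,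
    fun _ hε => ParallelScheduling.exists_isWSPT_le_div hm hε⟩,
    2, fun _ hm => ParallelScheduling.wsptRatio_rate hm⟩
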